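/- Let $d\in\mathbb N$ and $[d]=\{1,\dots,d\}$. Let $A\in\mathbb R^{d\times d}$, and let $P\in\mathbb R^{d\times d}$ be the transition matrix (non-negative entries, rows summing to one) of an irreducible and aperiodic Markov chain $X(0),X(1),\dots$ on $[d]$ with an arbitrary initial distribution. The regenerative Ulam–von Neumann algorithm keeps three $d\times d$ matrices $\Lambda,\Sigma,\Gamma$, all zero at the start, and at the $n$-th transition of the chain, from $i=X(n-1)$ to $j=X(n)$, it performs in this order: 1. $\Lambda_{ik}\leftarrow\Lambda_{ik}+\mathbb 1_{[\Lambda_{ik}=0]}$ for all $k\in[d]$; 2. $\Lambda\leftarrow \frac{A_{ij}}{P_{ij}}\,\Lambda$; 3. $\Gamma_{kj}\leftarrow\Gamma_{kj}+1$ for all $k\in[d]$ with $\Lambda_{kj}\neq0$; 4. $\Sigma_{kj}\leftarrow\Sigma_{kj}+\Lambda_{kj}$ for all $k\in[d]$; 5. $\Lambda_{kj}\leftarrow0$ for all $k\in[d]$. Let $\Gamma^K$ be the matrix $\Gamma$ after $K$ transitions. Then there exist a real $d\times d$ matrix $\Gamma_s$ and a symmetric positive semi-definite $d^2\times d^2$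 matrix $\Sigma_s$, which depend on neither the initial distribution nor the realization of the chain, such that $$\sqrt K\left(\frac{\Gamma^K}{K}-\Gamma_s\right)$$ converges in distribution, as $K\to\infty$, to the centered $d^2$-variate normal distribution with covariance matrix $\Sigma_s$. -/

import Mathlib

open MeasureTheory ProbabilityTheory Filter

/-- The stochastic matrix `P` is aperiodic: for every state `i`, the greatest common divisor of
`{k ≥ 1 | (P ^ k) i i > 0}` is `1`, i.e. `1` is the only common divisor of this set.
(If the set were empty, every `m` would be a common divisor, and the condition fails.) -/
def IsAperiodicMatrix {d : ℕ} (P : Matrix (Fin d) (Fin d) ℝ) : Prop :=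
  ∀ i : Fin d, ∀ m : ℕ, (∀ k : ℕ, 0 < k → 0 < (P ^ k) i i → m ∣ k) → m = 1

/-- `X` is a Markov chain with state space `Fin d` and transition matrix `P` under `μ`; the law of
`X 0` is arbitrary. The Markov property is written without conditioning:
`μ(X₀ = x₀, …, Xₙ₊₁ = xₙ₊₁) = μ(X₀ = x₀, …, Xₙ = xₙ) * P xₙ xₙ₊₁`. -/
structure IsMarkovChain {d : ℕ} {Ω : Type*} [MeasurableSpace Ω]
    (P : Matrix (Fin d) (Fin d) ℝ) (X : ℕ → Ω → Fin d) (μ : Measure Ω) : Prop where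
  measurable : ∀ n, Measurable (X n)
  markov : ∀ (n : ℕ) (x : ℕ → Fin d),
    μ.real {ω | ∀ k ≤ n + 1, X k ω = x k} =
      μ.real {ω | ∀ k ≤ n, X k ω = x k} * P (x n) (x (n + 1))

/-- The variables of the regenerative Ulam-von Neumann algorithm: the current state of the chain,
the running weights `Λ`, the cumulative weights `Σ` and the cycle counts `Γ`. -/
structure RuvnState (d : ℕ) where
  cur : Fin d
  Lam : Matrix (Fin d) (Fin d) ℝ
  Sig : Matrix (Fin d) (Fin d) ℝ
  Gam : Matrix (Fin d) (Fin d) ℕ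

namespace RuvnState

/-- All matrices are zero when the chain starts, in state `i`. -/
def start {d : ℕ} (i : Fin d) : RuvnState d where
  cur := i
  Lam := 0
  Sig := 0
  Gam := 0

/-- First update of a pass: `Λ i k ← Λ i k + 1_[Λ i k = 0]` for all `k` (row `i` only). -/
noncomputable def fillRow {d : ℕ} (i : Fin d) (L : Matrix (Fin d) (Fin d) ℝ) :
    Matrix (Fin d) (Fin d) ℝ :=
  Matrix.of fun u v => if u = i then L u v + (if L u v = 0 then 1 else 0) else L u v

/-- The value of `Λ` in a pass of the loop, after row `i` (the current state) has been filled and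
`Λ` has been multiplied by `A i j / P i j`, where `j` is the sampled next state. -/
noncomputable def weighted {d : ℕ} (A P : Matrix (Fin d) (Fin d) ℝ) (s : RuvnState d)
    (j : Fin d) : Matrix (Fin d) (Fin d) ℝ :=
  (A s.cur j / P s.cur j) • fillRow s.cur s.Lam

/-- One pass of the loop, with `j` the sampled next state: fill row `i` of `Λ` and rescale `Λ`;
increase `Γ k j` by one for those `k` with `Λ k j ≠ 0`; add column `j` of `Λ` to column `j` of
`Σ`; reset column `j` of `Λ` to zero; overwrite `i ← j`. -/
noncomputable def step {d : ℕ} (A P : Matrix (Fin d) (Fin d) ℝ) (s : RuvnState d) (j : Fin d) :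
    RuvnState d where
  cur := j
  Gam := Matrix.of fun u v =>
    if v = j ∧ weighted A P s j u v ≠ 0 then s.Gam u v + 1 else s.Gam u v
  Sig := Matrix.of fun u v => if v = j then s.Sig u v + weighted A P s j u v else s.Sig u v
  Lam := Matrix.of fun u v => if v = j then 0 else weighted A P s j u v

/-- The variables after `K` transitions, when the trajectory of the chain is `x 0, x 1, …`. -/
noncomputable def run {d : ℕ} (A P : Matrix (Fin d) (Fin d) ℝ) (x : ℕ → Fin d) :
    ℕ → RuvnState d
  | 0 => start (x 0)
  | K + 1 => step A P (run A P x K) (x (K + 1))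

end RuvnState

/-- The random count matrix `Γ^K` formed by the algorithm after `K` transitions of the chain. -/
noncomputable def countMatrix {d : ℕ} {Ω : Type*} (A P : Matrix (Fin d) (Fin d) ℝ)
    (X : ℕ → Ω → Fin d) (K : ℕ) (ω : Ω) : Matrix (Fin d) (Fin d) ℕ :=
  (RuvnState.run A P (fun n => X n ω) K).Gam

/-- `√K (Γ^K / K - G)`, as a random vector in the Euclidean space of dimension `d²`. -/
noncomputable def scaledCount {d : ℕ} {Ω : Type*} (A P : Matrix (Fin d) (Fin d) ℝ)
    (X : ℕ → Ω → Fin d) (G : Matrix (Fin d) (Fin d) ℝ) (K : ℕ) (ω : Ω) :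
    EuclideanSpace ℝ (Fin d × Fin d) :=
  WithLp.toLp 2 fun p =>
    Real.sqrt (K : ℝ) * ((countMatrix A P X K ω p.1 p.2 : ℝ) / (K : ℝ) - G p.1 p.2)

/-!
Let `N` be the set of positions of the non-zero entries of `Λ`. The pair `Z = (current state, N)` is
a chain on a finite set whose transitions are functions of `Z` and of the next state of `X`, and an
entry of `Γ` is a sum of indicators of the transitions of `Z`. The theorem is therefore a central
limit theorem for additive functionals of a finite Markov chain.

The chain `Z` need not be irreducible, but any two of its states can reach a common state
(`exists_common_pattern`): bring the current states together by irreducibility of `P`, then follow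
one path through all the states. Entering the state `j` clears column `j`, so the columns in which
the two patterns differ disappear one after the other. By the maximum principle the harmonic
functions of `Z` are then constant, and by a dimension count the Poisson equation `g = c + h - Q h`,
with `Q` the transition operator, is solvable for every `g` (`exists_poisson`).

Two applications give the limit theorem. With the solutions for the mean increments, `Γ` is
a deterministic drift plus a sum of centred increments plus a bounded term
(`drivenSum_eq_add_coboundary`). For a linear combination `D` of the centred increments, solve the
equation once more, for the conditional second moment: it equals `v + w - Q w`, and the constants
`v` are the values of the quadratic form of the limiting covariance matrix. Then `1 - s² w / 2` is,
up to `O(|s|³)`, an eigenfunction, with eigenvalue `1 - s² v / 2`, of the transition operator twisted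
by `exp (i s D)` (`exists_twisted_eigenfunction_bound`). Iterating `K` times with `s = 1 / √K` shows
that the characteristic functions converge to `exp (-v / 2)` (`tendsto_integral_cexp_drivenSum`),
and Lévy's theorem concludes.
-/

/-! ### The Poisson equation of a finite chain driven by random letters -/

section Poisson

variable {S E : Type*} [Fintype E]

/-- One step of positive probability: from `z` a letter `j` is drawn with probability `p z j`,
and the chain moves to `next z j`. -/
def PossibleStep (p : S → E → ℝ) (next : S → E → S) (z y : S) : Prop :=
  ∃ j, 0 < p z j ∧ next z j = y

variable {p : S → E → ℝ} {next : S → E → S}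

/-- The maximum principle: the set where a harmonic function is maximal is closed under the
steps of positive probability. -/
lemma harmonic_eq_of_reflTransGen (hp : ∀ z j, 0 ≤ p z j) (hsum : ∀ z, ∑ j, p z j = 1)
    {h : S → ℝ} (hh : ∀ z, ∑ j, p z j * h (next z j) = h z) {m : ℝ} (hm : ∀ z, h z ≤ m)
    {z y : S} (hz : h z = m) (hzy : Relation.ReflTransGen (PossibleStep p next) z y) :
    h y = m := by
  induction hzy with
  | refl => exact hz
  | @tail b c _ hbc ih =>
    obtain ⟨j, hj, rfl⟩ := hbc
    have h0 : ∑ j, p b j * (m - h (next b j)) = 0 := by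
      simp_rw [mul_sub, Finset.sum_sub_distrib, ← Finset.sum_mul, hsum, hh, ih]; ring
    have h1 := (Finset.sum_eq_zero_iff_of_nonneg
      fun j _ => mul_nonneg (hp b j) (sub_nonneg.2 (hm (next b j)))).1 h0 j (Finset.mem_univ j)
    rcases mul_eq_zero.1 h1 with h2 | h2 <;> linarith

/-- If `g - c = h - Q h`, where `Q` is the transition operator, and `g` is non-negative, then so
is `c`: evaluate at a minimum of `h`. -/
lemma poisson_const_nonneg [Finite S] [Nonempty S] (hp : ∀ z j, 0 ≤ p z j)
    (hsum : ∀ z, ∑ j, p z j = 1) {g h : S → ℝ} {c : ℝ} (hg : ∀ z, 0 ≤ g z)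
    (hc : ∀ z, g z = c + h z - ∑ j, p z j * h (next z j)) : 0 ≤ c := by
  obtain ⟨z, hz⟩ := Finite.exists_min h
  have h1 : h z ≤ ∑ j, p z j * h (next z j) := by
    calc h z = ∑ j, p z j * h z := by rw [← Finset.sum_mul, hsum, one_mul]
      _ ≤ _ := Finset.sum_le_sum fun j _ => mul_le_mul_of_nonneg_left (hz _) (hp z j)
  linarith [hg z, hc z]

/-- Solvability of the Poisson equation. If any two states can reach a common state, then
`h ↦ h - Q h + h z₀` is injective by the maximum principle, hence surjective. -/
lemma exists_poisson [Finite S] [Nonempty S] (hp : ∀ z j, 0 ≤ p z j)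
    (hsum : ∀ z, ∑ j, p z j = 1)
    (hmerge : ∀ z z', ∃ y, Relation.ReflTransGen (PossibleStep p next) z y ∧
      Relation.ReflTransGen (PossibleStep p next) z' y) (g : S → ℝ) :
    ∃ (c : ℝ) (h : S → ℝ), ∀ z, g z = c + h z - ∑ j, p z j * h (next z j) := by
  obtain ⟨z₀⟩ := ‹Nonempty S›
  let T : (S → ℝ) →ₗ[ℝ] (S → ℝ) :=
    { toFun := fun h z => h z₀ + h z - ∑ j, p z j * h (next z j)
      map_add' := fun h h' => by
        ext z; simp only [Pi.add_apply, mul_add, Finset.sum_add_distrib]; ring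
      map_smul' := fun a h => by
        ext z
        simp only [Pi.smul_apply, smul_eq_mul, RingHom.id_apply, mul_sub, mul_add, Finset.mul_sum]
        congr 1; exact Finset.sum_congr rfl fun j _ => by ring }
  have hinj : Function.Injective T := by
    refine (injective_iff_map_eq_zero T).2 fun h hT => ?_
    have hT' : ∀ z, 0 = h z₀ + h z - ∑ j, p z j * h (next z j) := fun z => (congrFun hT z).symm
    have hT'' : ∀ z, 0 = -h z₀ + (-h) z - ∑ j, p z j * (-h) (next z j) := fun z => by
      have := hT' z
      simp only [Pi.neg_apply, mul_neg, Finset.sum_neg_distrib]; linarith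
    have h1 := poisson_const_nonneg (g := fun _ => 0) hp hsum (fun _ => le_rfl) hT'
    have h2 := poisson_const_nonneg (g := fun _ => 0) hp hsum (fun _ => le_rfl) hT''
    have h0 : h z₀ = 0 := by linarith
    have hh : ∀ z, ∑ j, p z j * h (next z j) = h z := fun z => by linarith [hT' z]
    have hh' : ∀ z, ∑ j, p z j * (-h) (next z j) = (-h) z := fun z => by
      simp only [Pi.neg_apply, mul_neg, Finset.sum_neg_distrib, hh]
    have : Nonempty S := ⟨z₀⟩
    obtain ⟨a, ha⟩ := Finite.exists_max h
    obtain ⟨b, hb⟩ := Finite.exists_min h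
    obtain ⟨y, hay, hby⟩ := hmerge a b
    have e1 := harmonic_eq_of_reflTransGen hp hsum hh ha rfl hay
    have e2 := harmonic_eq_of_reflTransGen hp hsum hh' (m := -h b)
      (fun z => neg_le_neg (hb z)) rfl hby
    simp only [Pi.neg_apply, neg_inj] at e2
    ext z
    have := ha z; have := hb z; have := ha z₀; have := hb z₀
    simp only [Pi.zero_apply]; linarith
  obtain ⟨h, rfl⟩ := LinearMap.injective_iff_surjective.1 hinj g
  exact ⟨h z₀, h, fun z => rfl⟩

end Poisson

/-! ### The twisted transition operator -/

section Twisted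

open Complex

lemma norm_cexp_I_mul_taylor_two_le (x : ℝ) :
    ‖cexp (I * x) - (1 + I * x - x ^ 2 / 2)‖ ≤ |x| ^ 3 * Real.exp |x| := by
  have h := norm_exp_sub_sum_le_norm_mul_exp (I * x) 3
  simp only [norm_mul, norm_I, one_mul, norm_real, Real.norm_eq_abs] at h
  refine le_trans (le_of_eq ?_) h
  congr 2
  simp only [Finset.sum_range_succ, Finset.sum_range_zero, mul_pow, I_sq, Nat.factorial]
  push_cast
  ring

/-- For centred increments `D` with second moments `v + w - Q w`, the function `1 - s² w / 2` is,
up to `O(|s|³)`, an eigenfunction of the transition operator twisted by `exp (i s D)`, with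
eigenvalue `1 - s² v / 2`. -/
lemma exists_twisted_eigenfunction_bound {S E : Type*} [Finite S] [Fintype E]
    {p : S → E → ℝ} {next : S → E → S} (hp : ∀ z j, 0 ≤ p z j) (hsum : ∀ z, ∑ j, p z j = 1)
    {D : S → E → ℝ} {v : ℝ} {w : S → ℝ} (hD : ∀ z, ∑ j, p z j * D z j = 0)
    (hw : ∀ z, ∑ j, p z j * D z j ^ 2 = v + w z - ∑ j, p z j * w (next z j)) :
    ∃ C : ℝ, ∀ s : ℝ, |s| ≤ 1 → ∀ z,
      ‖∑ j, (p z j : ℂ) * (cexp (I * (s * D z j : ℝ)) * ((1 - s ^ 2 / 2 * w (next z j) : ℝ) : ℂ)) -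
        ((1 - s ^ 2 / 2 * v : ℝ) : ℂ) * ((1 - s ^ 2 / 2 * w z : ℝ) : ℂ)‖ ≤ C * |s| ^ 3 := by
  obtain ⟨B, hB⟩ := (Set.finite_range fun q : S × E => |D q.1 q.2|).bddAbove
  obtain ⟨W, hW⟩ := (Set.finite_range fun z : S => |w z|).bddAbove
  replace hB : ∀ z j, |D z j| ≤ max B 0 := fun z j => (hB ⟨(z, j), rfl⟩).trans (le_max_left _ _)
  replace hW : ∀ z, |w z| ≤ max W 0 := fun z => (hW ⟨z, rfl⟩).trans (le_max_left _ _)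
  have hB0 : 0 ≤ max B 0 := le_max_right _ _
  have hW0 : 0 ≤ max W 0 := le_max_right _ _
  generalize max B 0 = B at hB hB0
  generalize max W 0 = W at hW hW0
  refine ⟨B ^ 3 * Real.exp B + B * W / 2 + |v| * W / 4, fun s hs z => ?_⟩
  have hs0 := abs_nonneg s
  -- The remainder of second order of the exponential, and the remainder of order zero.
  let r : E → ℂ := fun j => cexp (I * (s * D z j : ℝ)) -
    (1 + I * (s * D z j : ℝ) - ((s * D z j : ℝ) : ℂ) ^ 2 / 2)
  let e : E → ℂ := fun j => cexp (I * (s * D z j : ℝ)) - 1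
  have hsD : ∀ j, |s * D z j| ≤ |s| * B := fun j => by
    rw [abs_mul]; exact mul_le_mul_of_nonneg_left (hB z j) hs0
  have hr : ∀ j, ‖r j‖ ≤ |s| ^ 3 * (B ^ 3 * Real.exp B) := fun j => by
    refine (norm_cexp_I_mul_taylor_two_le _).trans ?_
    calc |s * D z j| ^ 3 * Real.exp |s * D z j| ≤ (|s| * B) ^ 3 * Real.exp B := by
          gcongr
          · exact hsD j
          · exact (hsD j).trans (mul_le_of_le_one_left hB0 hs)
      _ = _ := by ring
  have he : ∀ j, ‖e j‖ ≤ |s| * B := fun j =>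
    (Real.norm_exp_I_mul_ofReal_sub_one_le).trans (hsD j)
  have hsumC : ∑ j, (p z j : ℂ) = 1 := by exact_mod_cast hsum z
  have hDC : ∑ j, (p z j : ℂ) * (D z j : ℂ) = 0 := by exact_mod_cast hD z
  have hwC : ∑ j, (p z j : ℂ) * (D z j : ℂ) ^ 2 =
      v + w z - ∑ j, (p z j : ℂ) * (w (next z j) : ℂ) := by exact_mod_cast hw z
  have key : ∑ j, (p z j : ℂ) *
        (cexp (I * (s * D z j : ℝ)) * ((1 - s ^ 2 / 2 * w (next z j) : ℝ) : ℂ)) -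
        ((1 - s ^ 2 / 2 * v : ℝ) : ℂ) * ((1 - s ^ 2 / 2 * w z : ℝ) : ℂ) =
      ∑ j, (p z j : ℂ) * r j - (s : ℂ) ^ 2 / 2 * ∑ j, (p z j : ℂ) * (e j * w (next z j)) -
        (s : ℂ) ^ 4 / 4 * v * w z := by
    have h1 : ∀ j, (p z j : ℂ) *
        (cexp (I * (s * D z j : ℝ)) * ((1 - s ^ 2 / 2 * w (next z j) : ℝ) : ℂ)) =
        p z j * r j + p z j + I * s * (p z j * D z j) - (s : ℂ) ^ 2 / 2 * (p z j * D z j ^ 2) -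
        (s : ℂ) ^ 2 / 2 * (p z j * (e j * w (next z j))) -
        (s : ℂ) ^ 2 / 2 * (p z j * w (next z j)) := fun j => by
      simp only [r, e]; push_cast; ring
    simp only [h1, Finset.sum_sub_distrib, Finset.sum_add_distrib, ← Finset.mul_sum, hsumC, hDC,
      hwC]
    push_cast; ring
  have havg : ∀ (F : E → ℂ) (b : ℝ), (∀ j, ‖F j‖ ≤ b) → ‖∑ j, (p z j : ℂ) * F j‖ ≤ b := by
    intro F b hF
    calc ‖∑ j, (p z j : ℂ) * F j‖ ≤ ∑ j, p z j * b := by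
          refine norm_sum_le_of_le _ fun j _ => ?_
          rw [norm_mul, norm_real, Real.norm_of_nonneg (hp z j)]
          exact mul_le_mul_of_nonneg_left (hF j) (hp z j)
      _ = b := by rw [← Finset.sum_mul, hsum, one_mul]
  rw [key]
  have b1 := havg r _ hr
  have b2 := havg (fun j => e j * w (next z j)) (|s| * B * W) fun j => by
    rw [norm_mul, norm_real]
    exact mul_le_mul (he j) (hW _) (norm_nonneg _) (by positivity)
  have b3 : ‖(s : ℂ) ^ 4 / 4 * v * w z‖ ≤ |s| ^ 3 * (|v| * W / 4) := by
    have : ‖(s : ℂ) ^ 4 / 4 * v * w z‖ = |s| ^ 3 * |s| / 4 * |v| * |w z| := by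
      simp only [norm_mul, norm_div, norm_pow, norm_real, Real.norm_eq_abs, norm_ofNat]; ring
    rw [this]
    calc |s| ^ 3 * |s| / 4 * |v| * |w z| ≤ |s| ^ 3 * 1 / 4 * |v| * W := by
          gcongr; exact hW z
      _ = _ := by ring
  have b4 : ‖(s : ℂ) ^ 2 / 2 * ∑ j, (p z j : ℂ) * (e j * w (next z j))‖ ≤
      |s| ^ 3 * (B * W / 2) := by
    rw [norm_mul]
    have : ‖(s : ℂ) ^ 2 / 2‖ = |s| ^ 2 / 2 := by simp
    rw [this]
    calc _ ≤ |s| ^ 2 / 2 * (|s| * B * W) := by gcongr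
      _ = _ := by ring
  calc _ ≤ _ := (norm_sub_le _ _).trans (add_le_add_left (norm_sub_le _ _) _)
    _ ≤ |s| ^ 3 * (B ^ 3 * Real.exp B) + |s| ^ 3 * (B * W / 2) + |s| ^ 3 * (|v| * W / 4) :=
      add_le_add (add_le_add b1 b4) b3
    _ = _ := by ring

end Twisted

/-! ### The Markov property for functions of the history -/

section History

variable {d : ℕ} {Ω : Type*} {X : ℕ → Ω → Fin d}

lemma exists_eq_comp_history {β : Type*} [Nonempty β] {n : ℕ} {Y : Ω → β}
    (hY : ∀ ω ω', (∀ k ≤ n, X k ω = X k ω') → Y ω = Y ω') :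
    ∃ Φ : (Fin (n + 1) → Fin d) → β, ∀ ω, Y ω = Φ fun k => X k ω := by
  have : Function.FactorsThrough Y fun ω (k : Fin (n + 1)) => X k ω := fun ω ω' h =>
    hY ω ω' fun k hk => congrFun h ⟨k, by omega⟩
  obtain ⟨Φ, hΦ⟩ := (Function.factorsThrough_iff Y).1 this
  exact ⟨Φ, fun ω => congrFun hΦ ω⟩

variable [MeasurableSpace Ω] {μ : Measure Ω} {P : Matrix (Fin d) (Fin d) ℝ}

lemma measurable_history (hX : ∀ n, Measurable (X n)) (n : ℕ) :
    Measurable fun ω (k : Fin (n + 1)) => X k ω :=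
  measurable_pi_lambda _ fun k => hX k

lemma measurable_of_history {β : Type*} [MeasurableSpace β] [Nonempty β]
    (hX : ∀ n, Measurable (X n)) {n : ℕ} {Y : Ω → β}
    (hY : ∀ ω ω', (∀ k ≤ n, X k ω = X k ω') → Y ω = Y ω') : Measurable Y := by
  obtain ⟨Φ, hΦ⟩ := exists_eq_comp_history hY
  rw [funext hΦ]
  exact (measurable_of_finite Φ).comp (measurable_history hX n)

lemma integrable_of_history [IsFiniteMeasure μ] (hX : ∀ n, Measurable (X n)) {n : ℕ} {Y : Ω → ℂ}
    (hY : ∀ ω ω', (∀ k ≤ n, X k ω = X k ω') → Y ω = Y ω') : Integrable Y μ := by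
  obtain ⟨Φ, hΦ⟩ := exists_eq_comp_history hY
  rw [funext hΦ]
  exact Integrable.comp_measurable (Integrable.of_finite (f := Φ)) (measurable_history hX n)

lemma integral_comp_eq_sum {α : Type*} [Fintype α] [MeasurableSpace α]
    [MeasurableSingletonClass α] [IsFiniteMeasure μ] {T : Ω → α} (hT : Measurable T)
    (F : α → ℂ) : ∫ ω, F (T ω) ∂μ = ∑ t, (μ.real {ω | T ω = t} : ℂ) * F t := by
  rw [← integral_map hT.aemeasurable (measurable_of_finite F).aestronglyMeasurable,
    integral_fintype (Integrable.of_finite)]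
  refine Finset.sum_congr rfl fun t _ => ?_
  rw [map_measureReal_apply hT (measurableSet_singleton t)]
  exact Complex.real_smul

lemma measureReal_history_succ (hX : IsMarkovChain P X μ) (n : ℕ) (y : Fin (n + 1) → Fin d)
    (j : Fin d) :
    μ.real {ω | ((fun k : Fin (n + 1) => X k ω), X (n + 1) ω) = (y, j)} =
      μ.real {ω | (fun k : Fin (n + 1) => X k ω) = y} * P (y (Fin.last n)) j := by
  let x : ℕ → Fin d := fun k => if h : k < n + 1 then y ⟨k, h⟩ else j
  have hx : ∀ k (h : k < n + 1), x k = y ⟨k, h⟩ := fun k h => dif_pos h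
  have hx1 : x (n + 1) = j := dif_neg (lt_irrefl _)
  have h0 : {ω | (fun k : Fin (n + 1) => X k ω) = y} = {ω | ∀ k ≤ n, X k ω = x k} := by
    ext ω
    simp only [Set.mem_ofPred_eq, funext_iff, Fin.forall_iff]
    exact ⟨fun h k hk => (h k (by omega)).trans (hx k (by omega)).symm,
      fun h k hk => (h k (by omega)).trans (hx k hk)⟩
  have h1 : {ω | ((fun k : Fin (n + 1) => X k ω), X (n + 1) ω) = (y, j)} =
      {ω | ∀ k ≤ n + 1, X k ω = x k} := by
    ext ω
    have := Set.ext_iff.1 h0 ω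
    simp only [Set.mem_ofPred_eq] at this
    simp only [Set.mem_ofPred_eq, Prod.mk.injEq, this]
    constructor
    · rintro ⟨h, rfl⟩ k hk
      rcases Nat.le_succ_iff.1 hk with hk | rfl
      · exact h k hk
      · exact hx1.symm
    · exact fun h => ⟨fun k hk => h k (by omega), (h _ le_rfl).trans hx1⟩
  have h := hX.markov n x
  rwa [← h0, ← h1, hx n (by omega), hx1] at h

/-- The Markov property, tested on a function of the history `X 0, …, X n` (through `Y`) and of
the next state. -/
lemma integral_markov [IsProbabilityMeasure μ] (hX : IsMarkovChain P X μ) {β : Type*} {n : ℕ}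
    {Y : Ω → β} (hY : ∀ ω ω', (∀ k ≤ n, X k ω = X k ω') → Y ω = Y ω') (Ψ : β → Fin d → ℂ) :
    ∫ ω, Ψ (Y ω) (X (n + 1) ω) ∂μ = ∫ ω, ∑ j, (P (X n ω) j : ℂ) * Ψ (Y ω) j ∂μ := by
  obtain ⟨ω₀⟩ : Nonempty Ω := nonempty_of_isProbabilityMeasure μ
  have : Nonempty β := ⟨Y ω₀⟩
  obtain ⟨Φ, hΦ⟩ := exists_eq_comp_history hY
  have hm := measurable_history hX.measurable n
  simp_rw [hΦ]
  have e1 := integral_comp_eq_sum (μ := μ) (hm.prodMk (hX.measurable (n + 1)))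
    fun q => Ψ (Φ q.1) q.2
  have e2 := integral_comp_eq_sum (μ := μ) hm
    fun y => ∑ j, (P (y (Fin.last n)) j : ℂ) * Ψ (Φ y) j
  simp only [Fin.val_last] at e1 e2
  rw [e1, e2, Fintype.sum_prod_type]
  refine Finset.sum_congr rfl fun y _ => ?_
  rw [Finset.mul_sum]
  refine Finset.sum_congr rfl fun j _ => ?_
  rw [measureReal_history_succ hX n y j]
  push_cast; ring

end History

/-! ### Additive functionals of a chain driven by the Markov chain -/

section Driven

/-- The states visited when the letters `x 0, x 1, …` are read: the first letter chooses the
initial state, every later one a transition. -/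
def drivenPath {S E : Type*} (init : E → S) (next : S → E → S) (x : ℕ → E) : ℕ → S
  | 0 => init (x 0)
  | n + 1 => next (drivenPath init next x n) (x (n + 1))

/-- The additive functional `∑ f (state, next letter)` over the first `K` transitions. -/
def drivenSum {S E : Type*} (init : E → S) (next : S → E → S) (f : S → E → ℝ) (x : ℕ → E)
    (K : ℕ) : ℝ :=
  ∑ n ∈ Finset.range K, f (drivenPath init next x n) (x (n + 1))

variable {S E : Type*} {init : E → S} {next : S → E → S}

lemma drivenPath_congr {x x' : ℕ → E} {n : ℕ} (h : ∀ k ≤ n, x k = x' k) :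
    drivenPath init next x n = drivenPath init next x' n := by
  induction n with
  | zero => simp [drivenPath, h]
  | succ n ih => simp [drivenPath, h, ih fun k hk => h k (by omega)]

lemma drivenSum_congr {f : S → E → ℝ} {x x' : ℕ → E} {n : ℕ} (h : ∀ k ≤ n, x k = x' k) :
    drivenSum init next f x n = drivenSum init next f x' n := by
  refine Finset.sum_congr rfl fun k hk => ?_
  have := Finset.mem_range.1 hk
  rw [drivenPath_congr fun l hl => h l (by omega), h (k + 1) (by omega)]

lemma drivenSum_succ (f : S → E → ℝ) (x : ℕ → E) (n : ℕ) :
    drivenSum init next f x (n + 1) =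
      drivenSum init next f x n + f (drivenPath init next x n) (x (n + 1)) :=
  Finset.sum_range_succ _ _

lemma loc_drivenPath {loc : S → E} (hinit : ∀ i, loc (init i) = i)
    (hnext : ∀ z j, loc (next z j) = j) (x : ℕ → E) (n : ℕ) :
    loc (drivenPath init next x n) = x n := by
  cases n <;> simp [drivenPath, hinit, hnext]

open Complex

variable {d : ℕ} {Ω : Type*} [MeasurableSpace Ω] {X : ℕ → Ω → Fin d} {μ : Measure Ω}
  {P : Matrix (Fin d) (Fin d) ℝ}

/-- Central limit theorem for centred increments, in terms of characteristic functions. With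
`s = 1 / √K`, the means of `exp (i s M n) (1 - s² w (Z n) / 2)` are multiplied by `1 - s² v / 2`
at each step, up to an error `O(s³)`; over `K` steps the errors add up to `O(1 / √K)`. -/
lemma tendsto_integral_cexp_drivenSum [IsProbabilityMeasure μ] (hX : IsMarkovChain P X μ)
    {S : Type*} [Finite S] {init : Fin d → S} {next : S → Fin d → S} {loc : S → Fin d}
    (hinit : ∀ i, loc (init i) = i) (hnext : ∀ z j, loc (next z j) = j)
    (hp : ∀ i j, 0 ≤ P i j) (hsum : ∀ i, ∑ j, P i j = 1)
    {D : S → Fin d → ℝ} {v : ℝ} (hv : 0 ≤ v) {w : S → ℝ}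
    (hD : ∀ z, ∑ j, P (loc z) j * D z j = 0)
    (hw : ∀ z, ∑ j, P (loc z) j * D z j ^ 2 = v + w z - ∑ j, P (loc z) j * w (next z j)) :
    Tendsto (fun K : ℕ => ∫ ω, cexp (I * ((√(K : ℝ))⁻¹ *
      drivenSum init next D (fun n => X n ω) K : ℝ)) ∂μ) atTop
      (nhds ((Real.exp (-v / 2) : ℝ) : ℂ)) := by
  obtain ⟨C, hC⟩ := exists_twisted_eigenfunction_bound (p := fun z j => P (loc z) j)
    (fun z j => hp (loc z) j) (fun z => hsum (loc z)) hD hw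
  obtain ⟨W, hW⟩ := (Set.finite_range fun z : S => |w z|).bddAbove
  replace hW : ∀ z, |w z| ≤ max W 0 := fun z => (hW ⟨z, rfl⟩).trans (le_max_left _ _)
  have hW0 : 0 ≤ max W 0 := le_max_right _ _
  generalize max W 0 = W at hW hW0
  let Z : Ω → ℕ → S := fun ω => drivenPath init next fun n => X n ω
  let M : Ω → ℕ → ℝ := fun ω => drivenSum init next D fun n => X n ω
  have hZc : ∀ n ω ω', (∀ k ≤ n, X k ω = X k ω') → Z ω n = Z ω' n := fun n ω ω' h =>
    drivenPath_congr h
  have hMc : ∀ n ω ω', (∀ k ≤ n, X k ω = X k ω') → M ω n = M ω' n := fun n ω ω' h =>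
    drivenSum_congr h
  have hloc : ∀ ω n, loc (Z ω n) = X n ω := fun ω n => loc_drivenPath hinit hnext _ n
  have hint1 : ∀ (s : ℝ) n, Integrable (fun ω => cexp (I * (s * M ω n : ℝ))) μ := fun s n =>
    integrable_of_history hX.measurable fun ω ω' h => by rw [hMc n ω ω' h]
  have hint2 : ∀ (s : ℝ) n, Integrable (fun ω => cexp (I * (s * M ω n : ℝ)) *
      ((1 - s ^ 2 / 2 * w (Z ω n) : ℝ) : ℂ)) μ := fun s n =>
    integrable_of_history hX.measurable fun ω ω' h => by rw [hMc n ω ω' h, hZc n ω ω' h]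
  let T : ℝ → ℕ → ℂ := fun s n => ∫ ω, cexp (I * (s * M ω n : ℝ)) *
    ((1 - s ^ 2 / 2 * w (Z ω n) : ℝ) : ℂ) ∂μ
  have hnorm : ∀ x : ℝ, ‖cexp (I * x)‖ = 1 := fun x => by
    rw [mul_comm]; exact norm_exp_ofReal_mul_I x
  -- The corrected means differ from the characteristic function by `O(s²)`.
  have hT : ∀ s n, ‖T s n - ∫ ω, cexp (I * (s * M ω n : ℝ)) ∂μ‖ ≤ s ^ 2 / 2 * W := fun s n => by
    rw [← integral_sub (hint2 s n) (hint1 s n)]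
    refine (norm_integral_le_of_norm_le_const (C := s ^ 2 / 2 * W)
      (Eventually.of_forall fun ω => ?_)).trans (by simp)
    rw [show cexp (I * (s * M ω n : ℝ)) * ((1 - s ^ 2 / 2 * w (Z ω n) : ℝ) : ℂ) -
      cexp (I * (s * M ω n : ℝ)) = cexp (I * (s * M ω n : ℝ)) *
        ((-(s ^ 2 / 2 * w (Z ω n)) : ℝ) : ℂ) by push_cast; ring, norm_mul, hnorm, one_mul,
      norm_real, norm_neg, Real.norm_eq_abs, abs_mul, abs_of_nonneg (by positivity)]
    exact mul_le_mul_of_nonneg_left (hW _) (by positivity)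
  have hstep : ∀ s n, |s| ≤ 1 →
      ‖T s (n + 1) - ((1 - s ^ 2 / 2 * v : ℝ) : ℂ) * T s n‖ ≤ C * |s| ^ 3 := fun s n hs => by
    let F : ℝ × S → Fin d → ℂ := fun q j => cexp (I * (s * q.1 : ℝ)) *
      (cexp (I * (s * D q.2 j : ℝ)) * ((1 - s ^ 2 / 2 * w (next q.2 j) : ℝ) : ℂ))
    have e1 : T s (n + 1) = ∫ ω, F (M ω n, Z ω n) (X (n + 1) ω) ∂μ := by
      refine integral_congr_ae (Eventually.of_forall fun ω => ?_)
      have h1 : M ω (n + 1) = M ω n + D (Z ω n) (X (n + 1) ω) := drivenSum_succ _ _ _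
      have h2 : Z ω (n + 1) = next (Z ω n) (X (n + 1) ω) := rfl
      simp only [F, h1, h2, ← mul_assoc, ← Complex.exp_add]
      push_cast; ring_nf
    have e2 := integral_markov hX (n := n) (Y := fun ω => (M ω n, Z ω n))
      (fun ω ω' h => by simp only [hMc n ω ω' h, hZc n ω ω' h]) F
    rw [e1, e2]
    simp only [T]
    rw [← integral_const_mul, ← integral_sub]
    · refine (norm_integral_le_of_norm_le_const (C := C * |s| ^ 3)
        (Eventually.of_forall fun ω => ?_)).trans (by simp)
      have := hC s hs (Z ω n)
      rw [hloc] at this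
      refine le_trans (le_of_eq ?_) this
      simp only [F, mul_left_comm _ (cexp (I * (s * M ω n : ℝ))), ← Finset.mul_sum]
      rw [← mul_sub, norm_mul, hnorm, one_mul]
    · exact integrable_of_history hX.measurable (n := n) fun ω ω' h => by
        simp only [hMc n ω ω' h, hZc n ω ω' h, h n le_rfl]
    · exact (hint2 s n).const_mul _
  have hiter : ∀ s n, |s| ≤ 1 → s ^ 2 * v ≤ 2 →
      ‖T s n - ((1 - s ^ 2 / 2 * v : ℝ) : ℂ) ^ n * T s 0‖ ≤ n * (C * |s| ^ 3) := by
    intro s n hs hsv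
    have hlam : ‖((1 - s ^ 2 / 2 * v : ℝ) : ℂ)‖ ≤ 1 := by
      rw [norm_real, Real.norm_eq_abs, abs_le]
      have : 0 ≤ s ^ 2 / 2 * v := by positivity
      constructor <;> linarith
    induction n with
    | zero => simp
    | succ n ih =>
      calc _ = ‖(T s (n + 1) - ((1 - s ^ 2 / 2 * v : ℝ) : ℂ) * T s n) +
            ((1 - s ^ 2 / 2 * v : ℝ) : ℂ) *
              (T s n - ((1 - s ^ 2 / 2 * v : ℝ) : ℂ) ^ n * T s 0)‖ := by congr 1; ring
        _ ≤ C * |s| ^ 3 + 1 * (n * (C * |s| ^ 3)) := by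
          refine (norm_add_le _ _).trans (add_le_add (hstep s n hs) ?_)
          rw [norm_mul]
          exact mul_le_mul hlam ih (norm_nonneg _) zero_le_one
        _ = _ := by push_cast; ring
  have hzero : ∀ s, ‖T s 0 - 1‖ ≤ s ^ 2 / 2 * W := fun s => by
    have := hT s 0
    simpa [M, drivenSum] using this
  -- The total error at time `K`, for `s = 1 / √K`.
  have hbound : ∀ᶠ K : ℕ in atTop, ‖(∫ ω, cexp (I * ((√(K : ℝ))⁻¹ * M ω K : ℝ)) ∂μ) -
      (((1 + (-v / 2) / K) ^ K : ℝ) : ℂ)‖ ≤ (K : ℝ)⁻¹ * W + C * (√(K : ℝ))⁻¹ := by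
    filter_upwards [eventually_ge_atTop 1, eventually_ge_atTop ⌈v⌉₊] with K hK1 hKv
    have hK : (1 : ℝ) ≤ K := by exact_mod_cast hK1
    have hKv : v ≤ K := Nat.ceil_le.1 hKv
    set s : ℝ := (√(K : ℝ))⁻¹ with hs_def
    have hs0 : 0 ≤ s := by positivity
    have hs2 : s ^ 2 = (K : ℝ)⁻¹ := by rw [hs_def, inv_pow, Real.sq_sqrt (by positivity)]
    have hs1 : |s| ≤ 1 := by
      rw [abs_of_nonneg hs0, hs_def]
      exact inv_le_one_of_one_le₀ (Real.one_le_sqrt.2 hK)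
    have hsv : s ^ 2 * v ≤ 2 := by
      rw [hs2, inv_mul_le_iff₀ (by positivity)]; linarith
    have e : (1 + (-v / 2) / K : ℝ) = 1 - s ^ 2 / 2 * v := by rw [hs2]; field_simp; ring
    have hlam : ‖((1 - s ^ 2 / 2 * v : ℝ) : ℂ) ^ K‖ ≤ 1 := by
      rw [norm_pow]
      refine pow_le_one₀ (norm_nonneg _) ?_
      rw [norm_real, Real.norm_eq_abs, abs_le]
      have : 0 ≤ s ^ 2 / 2 * v := by positivity
      constructor <;> linarith
    have a1 := hT s K
    have a2 := hiter s K hs1 hsv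
    have a3 := hzero s
    rw [e, ofReal_pow]
    have hK3 : (K : ℝ) * (C * |s| ^ 3) = C * s := by
      rw [abs_of_nonneg hs0, pow_succ, hs2]; field_simp
    calc _ = ‖-(T s K - ∫ ω, cexp (I * (s * M ω K : ℝ)) ∂μ) +
          (T s K - ((1 - s ^ 2 / 2 * v : ℝ) : ℂ) ^ K * T s 0) +
          ((1 - s ^ 2 / 2 * v : ℝ) : ℂ) ^ K * (T s 0 - 1)‖ := by congr 1; ring
      _ ≤ s ^ 2 / 2 * W + K * (C * |s| ^ 3) + 1 * (s ^ 2 / 2 * W) := by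
        refine (norm_add_le _ _).trans (add_le_add ((norm_add_le _ _).trans
          (add_le_add (by rwa [norm_neg]) a2)) ?_)
        rw [norm_mul]
        exact mul_le_mul hlam a3 (norm_nonneg _) zero_le_one
      _ = _ := by rw [hK3, hs2]; ring
  have hlim : Tendsto (fun K : ℕ => (((1 + (-v / 2) / K) ^ K : ℝ) : ℂ)) atTop
      (nhds ((Real.exp (-v / 2) : ℝ) : ℂ)) :=
    (continuous_ofReal.tendsto _).comp (Real.tendsto_one_add_div_pow_exp (-v / 2))
  have hzero' : Tendsto (fun K : ℕ => (K : ℝ)⁻¹ * W + C * (√(K : ℝ))⁻¹) atTop (nhds 0) := by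
    have h1 : Tendsto (fun K : ℕ => (K : ℝ)⁻¹) atTop (nhds 0) := tendsto_inv_atTop_nhds_zero_nat
    have h2 : Tendsto (fun K : ℕ => (√(K : ℝ))⁻¹) atTop (nhds 0) :=
      tendsto_inv_atTop_zero.comp (Real.tendsto_sqrt_atTop.comp tendsto_natCast_atTop_atTop)
    simpa using (h1.mul_const W).add (h2.const_mul C)
  simpa using (squeeze_zero_norm' hbound hzero').add hlim

end Driven

/-! ### The pattern of non-zero weights -/

section Pattern

variable {d : ℕ} {A P : Matrix (Fin d) (Fin d) ℝ}

/-- The transition of the pair (current state, set of positions of the non-zero entries of `Λ`)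
when the next state is `j`. This pair determines which entries of `Γ` increase; the values of the
non-zero weights play no role. If `P i j = 0`, the quotient `A i j / P i j` is `0`, here as in
`RuvnState.step`, so the two agree on every path and not only almost surely. -/
def patternStep (A P : Matrix (Fin d) (Fin d) ℝ) (z : Fin d × Set (Fin d × Fin d)) (j : Fin d) :
    Fin d × Set (Fin d × Fin d) :=
  (j, {q | q.2 ≠ j ∧ A z.1 j / P z.1 j ≠ 0 ∧ (q.1 = z.1 ∨ q ∈ z.2)})

open Classical in
/-- The increment of the entry `q` of `Γ` in the transition from `z` with next state `j`. -/
noncomputable def patternCount (A P : Matrix (Fin d) (Fin d) ℝ) (q : Fin d × Fin d)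
    (z : Fin d × Set (Fin d × Fin d)) (j : Fin d) : ℝ :=
  if q.2 = j ∧ A z.1 j / P z.1 j ≠ 0 ∧ (q.1 = z.1 ∨ q ∈ z.2) then 1 else 0

lemma RuvnState.weighted_ne_zero_iff (s : RuvnState d) (j u v : Fin d) :
    RuvnState.weighted A P s j u v ≠ 0 ↔
      A s.cur j / P s.cur j ≠ 0 ∧ (u = s.cur ∨ s.Lam u v ≠ 0) := by
  have : RuvnState.fillRow s.cur s.Lam u v ≠ 0 ↔ u = s.cur ∨ s.Lam u v ≠ 0 := by
    simp only [RuvnState.fillRow, Matrix.of_apply]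
    split_ifs <;> simp_all
  rw [RuvnState.weighted, Matrix.smul_apply, smul_eq_mul, mul_ne_zero_iff, this]

lemma drivenPath_patternStep (x : ℕ → Fin d) (n : ℕ) :
    drivenPath (fun i => (i, (∅ : Set (Fin d × Fin d)))) (patternStep A P) x n =
      ((RuvnState.run A P x n).cur, {q | (RuvnState.run A P x n).Lam q.1 q.2 ≠ 0}) := by
  induction n with
  | zero => simp [drivenPath, RuvnState.run, RuvnState.start]
  | succ n ih =>
    rw [drivenPath, ih]
    refine Prod.ext rfl (Set.ext fun q => ?_)
    by_cases h : q.2 = x (n + 1)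
    · simp [patternStep, RuvnState.run, RuvnState.step, h]
    · have := RuvnState.weighted_ne_zero_iff (A := A) (P := P) (RuvnState.run A P x n)
        (x (n + 1)) q.1 q.2
      simpa [patternStep, RuvnState.run, RuvnState.step, h] using this.symm

lemma run_Gam_eq_drivenSum (q : Fin d × Fin d) (x : ℕ → Fin d) (K : ℕ) :
    ((RuvnState.run A P x K).Gam q.1 q.2 : ℝ) =
      drivenSum (fun i => (i, (∅ : Set (Fin d × Fin d)))) (patternStep A P)
        (patternCount A P q) x K := by
  induction K with
  | zero => simp [drivenSum, RuvnState.run, RuvnState.start]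
  | succ n ih =>
    rw [drivenSum_succ, ← ih, drivenPath_patternStep]
    have := RuvnState.weighted_ne_zero_iff (A := A) (P := P) (RuvnState.run A P x n)
      (x (n + 1)) q.1 q.2
    simp only [RuvnState.run, RuvnState.step, Matrix.of_apply, patternCount, this,
      Set.mem_ofPred_eq]
    split_ifs <;> simp

/-- Two patterns are moved along the same path; a column in which they agree stays a column of
agreement, and they agree in the column of the last state, which has just been cleared. -/
lemma exists_reach_agree (hirr : P.IsIrreducible) {N N' : Set (Fin d × Fin d)}
    {U : Finset (Fin d)} (hU : ∀ q : Fin d × Fin d, q.2 ∉ U → (q ∈ N ↔ q ∈ N')) (i j : Fin d) :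
    ∃ M M', Relation.ReflTransGen (PossibleStep (fun z j => P z.1 j) (patternStep A P))
        (i, N) (j, M) ∧
      Relation.ReflTransGen (PossibleStep (fun z j => P z.1 j) (patternStep A P))
        (i, N') (j, M') ∧
      ∀ q : Fin d × Fin d, q.2 ∉ U.erase j → (q ∈ M ↔ q ∈ M') := by
  let R := PossibleStep (fun z j => P z.1 j) (patternStep A P)
  have hstep : ∀ (a b : Fin d) (M M' : Set (Fin d × Fin d)),
      (∀ q : Fin d × Fin d, q.2 ∉ U → (q ∈ M ↔ q ∈ M')) → ∀ q : Fin d × Fin d, q.2 ∉ U.erase b →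
        (q ∈ (patternStep A P (a, M) b).2 ↔ q ∈ (patternStep A P (a, M') b).2) := by
    intro a b M M' h q hq
    by_cases hqb : q.2 = b
    · simp [patternStep, hqb]
    · have := h q fun h' => hq (Finset.mem_erase.2 ⟨hqb, h'⟩)
      simp [patternStep, this]
  have hreach : ∀ a, Relation.ReflTransGen (fun a b => 0 < P a b) i a → ∃ M M',
      Relation.ReflTransGen R (i, N) (a, M) ∧ Relation.ReflTransGen R (i, N') (a, M') ∧
      ∀ q : Fin d × Fin d, q.2 ∉ U → (q ∈ M ↔ q ∈ M') := by
    intro a ha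
    induction ha with
    | refl => exact ⟨N, N', .refl, .refl, hU⟩
    | @tail a b _ hab ih =>
      obtain ⟨M, M', h1, h2, h3⟩ := ih
      exact ⟨_, _, h1.tail ⟨b, hab, rfl⟩, h2.tail ⟨b, hab, rfl⟩, fun q hq =>
        hstep a b M M' h3 q fun h => hq (Finset.mem_of_mem_erase h)⟩
  have hpath : ∃ a, Relation.ReflTransGen (fun a b => 0 < P a b) i a ∧ 0 < P a j := by
    let := P.toQuiver
    have hq : ∀ {a b : Fin d}, Quiver.Path a b →
        Relation.ReflTransGen (fun a b => 0 < P a b) a b := by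
      intro a b p
      induction p with
      | nil => exact .refl
      | cons _ e ih => exact ih.tail e.down
    obtain ⟨p, hp⟩ := hirr.connected i j
    cases p with
    | nil => simp at hp
    | cons p e => exact ⟨_, hq p, e.down⟩
  obtain ⟨a, ha, haj⟩ := hpath
  obtain ⟨M, M', h1, h2, h3⟩ := hreach a ha
  exact ⟨_, _, h1.tail ⟨j, haj, rfl⟩, h2.tail ⟨j, haj, rfl⟩, hstep a j M M' h3⟩

/-- Any two states of the pattern chain can reach a common state: once the current states agree,
a path through all states removes the difference between the patterns column by column. -/
lemma exists_common_pattern (hirr : P.IsIrreducible) (z z' : Fin d × Set (Fin d × Fin d)) :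
    ∃ y, Relation.ReflTransGen (PossibleStep (fun z j => P z.1 j) (patternStep A P)) z y ∧
      Relation.ReflTransGen (PossibleStep (fun z j => P z.1 j) (patternStep A P)) z' y := by
  have hsame : ∀ (U : Finset (Fin d)) (i : Fin d) (N N' : Set (Fin d × Fin d)),
      (∀ q : Fin d × Fin d, q.2 ∉ U → (q ∈ N ↔ q ∈ N')) →
      ∃ y, Relation.ReflTransGen (PossibleStep (fun z j => P z.1 j) (patternStep A P)) (i, N) y ∧
        Relation.ReflTransGen (PossibleStep (fun z j => P z.1 j) (patternStep A P)) (i, N') y := by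
    intro U
    induction U using Finset.induction_on with
    | empty =>
      intro i N N' h
      obtain rfl : N = N' := Set.ext fun q => h q (Finset.notMem_empty _)
      exact ⟨_, .refl, .refl⟩
    | insert j U hj ih =>
      intro i N N' h
      obtain ⟨M, M', h1, h2, h3⟩ := exists_reach_agree (A := A) hirr h i j
      rw [Finset.erase_insert hj] at h3
      obtain ⟨y, hy, hy'⟩ := ih j M M' h3
      exact ⟨y, h1.trans hy, h2.trans hy'⟩
  obtain ⟨i, N⟩ := z
  obtain ⟨i', N'⟩ := z'
  obtain ⟨M, -, h1, -, -⟩ := exists_reach_agree (A := A) (N := N) (N' := N) (U := ∅) hirr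
    (fun _ _ => Iff.rfl) i i'
  obtain ⟨y, hy, hy'⟩ := hsame Finset.univ i' M N' fun q hq => absurd (Finset.mem_univ _) hq
  exact ⟨y, h1.trans hy, hy'⟩

end Pattern

/-! ### The central limit theorem -/

section CLT

open Complex

/-- Removing the mean `c` and adding the coboundary of `h` changes an additive functional by a
deterministic drift and a bounded term. -/
lemma drivenSum_eq_add_coboundary {S E : Type*} {init : E → S} {next : S → E → S}
    (f : S → E → ℝ) (h : S → ℝ) (c : ℝ) (x : ℕ → E) (K : ℕ) :
    drivenSum init next f x K =
      drivenSum init next (fun z j => f z j - c + h (next z j) - h z) x K + K * c +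
        (h (drivenPath init next x 0) - h (drivenPath init next x K)) := by
  induction K with
  | zero => simp [drivenSum]
  | succ n ih =>
    rw [drivenSum_succ, drivenSum_succ, ih]
    simp only [drivenPath]
    push_cast; ring

lemma norm_cexp_I_mul_sub_le (x y : ℝ) : ‖cexp (I * x) - cexp (I * y)‖ ≤ |x - y| := by
  have : cexp (I * x) - cexp (I * y) = cexp (y * I) * (cexp (I * (x - y : ℝ)) - 1) := by
    rw [mul_sub, ← Complex.exp_add]; push_cast; ring_nf
  rw [this, norm_mul, norm_exp_ofReal_mul_I, one_mul]
  exact Real.norm_exp_I_mul_ofReal_sub_one_le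

variable {d : ℕ} {P : Matrix (Fin d) (Fin d) ℝ}

/-- Central limit theorem for vector-valued additive functionals of a finite chain driven by a
Markov chain, if any two states can reach a common state. The limit does not depend on the
initial distribution. -/
theorem exists_tendstoInDistribution_drivenSum.{u} (hp : ∀ i j, 0 ≤ P i j)
    (hsum : ∀ i, ∑ j, P i j = 1) {S : Type*} [Finite S] [Nonempty S]
    {init : Fin d → S} {next : S → Fin d → S} {loc : S → Fin d}
    (hinit : ∀ i, loc (init i) = i) (hnext : ∀ z j, loc (next z j) = j)
    (hmerge : ∀ z z', ∃ y,
      Relation.ReflTransGen (PossibleStep (fun z j => P (loc z) j) next) z y ∧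
        Relation.ReflTransGen (PossibleStep (fun z j => P (loc z) j) next) z' y)
    {ι : Type*} [Fintype ι] [DecidableEq ι] (f : ι → S → Fin d → ℝ) :
    ∃ (G : ι → ℝ) (V : Matrix ι ι ℝ), V.IsSymm ∧ V.PosSemidef ∧
      ∀ (Ω : Type u) [MeasurableSpace Ω] (μ : Measure Ω) [IsProbabilityMeasure μ]
        (X : ℕ → Ω → Fin d), IsMarkovChain P X μ →
        TendstoInDistribution (fun (K : ℕ) ω => (WithLp.toLp 2 fun q =>
            √(K : ℝ) * (drivenSum init next (f q) (fun n => X n ω) K / K - G q) :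
            EuclideanSpace ℝ ι)) atTop id (fun _ => μ) (multivariateGaussian 0 V) := by
  have hp' : ∀ (z : S) j, 0 ≤ P (loc z) j := fun z j => hp _ j
  have hsum' : ∀ z : S, ∑ j, P (loc z) j = 1 := fun z => hsum _
  choose c h hch using exists_poisson hp' hsum' hmerge
  -- `g q` are the mean increments, `D q` the centred increments (martingale differences), `gg q r`
  -- their conditional covariances and `V q r` the constants of the Poisson equation for `gg q r`.
  let g : ι → S → ℝ := fun q z => ∑ j, P (loc z) j * f q z j
  let D : ι → S → Fin d → ℝ := fun q z j =>
    f q z j - c (g q) + h (g q) (next z j) - h (g q) z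
  have hD : ∀ q z, ∑ j, P (loc z) j * D q z j = 0 := fun q z => by
    have := hch (g q) z
    simp only [D, mul_sub, mul_add, Finset.sum_sub_distrib, Finset.sum_add_distrib,
      ← Finset.sum_mul, hsum', one_mul]
    simp only [g] at this ⊢
    linarith
  let gg : ι → ι → S → ℝ := fun q r z => ∑ j, P (loc z) j * (D q z j * D r z j)
  let V : Matrix ι ι ℝ := Matrix.of fun q r => c (gg q r)
  let Dt : (ι → ℝ) → S → Fin d → ℝ := fun t z j => ∑ q, t q * D q z j
  let wt : (ι → ℝ) → S → ℝ := fun t z => ∑ q, ∑ r, t q * t r * h (gg q r) z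
  have hDt : ∀ t z, ∑ j, P (loc z) j * Dt t z j = 0 := fun t z => by
    simp only [Dt, Finset.mul_sum, mul_left_comm _ (t _)]
    rw [Finset.sum_comm]
    simp only [← Finset.mul_sum, hD, mul_zero, Finset.sum_const_zero]
  have hwt : ∀ t z, ∑ j, P (loc z) j * Dt t z j ^ 2 =
      t ⬝ᵥ V.mulVec t + wt t z - ∑ j, P (loc z) j * wt t (next z j) := fun t z => by
    have e1 : ∑ j, P (loc z) j * Dt t z j ^ 2 = ∑ q, ∑ r, t q * t r * gg q r z := by
      simp only [Dt, gg, sq, Finset.sum_mul_sum]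
      simp only [Finset.mul_sum]
      rw [Finset.sum_comm]
      refine Finset.sum_congr rfl fun q _ => ?_
      rw [Finset.sum_comm]
      exact Finset.sum_congr rfl fun r _ => Finset.sum_congr rfl fun j _ => by ring
    have e2 : t ⬝ᵥ V.mulVec t = ∑ q, ∑ r, t q * t r * c (gg q r) := by
      simp only [dotProduct, Matrix.mulVec, V, Matrix.of_apply, Finset.mul_sum]
      exact Finset.sum_congr rfl fun q _ => Finset.sum_congr rfl fun r _ => by ring
    have e3 : ∑ j, P (loc z) j * wt t (next z j) =
        ∑ q, ∑ r, t q * t r * ∑ j, P (loc z) j * h (gg q r) (next z j) := by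
      simp only [wt, Finset.mul_sum]
      rw [Finset.sum_comm]
      refine Finset.sum_congr rfl fun q _ => ?_
      rw [Finset.sum_comm]
      exact Finset.sum_congr rfl fun r _ => Finset.sum_congr rfl fun j _ => by ring
    rw [e1, e2, e3]
    simp only [wt, ← Finset.sum_add_distrib, ← Finset.sum_sub_distrib]
    exact Finset.sum_congr rfl fun q _ => Finset.sum_congr rfl fun r _ => by
      rw [hch (gg q r) z]; ring
  have hv : ∀ t : ι → ℝ, 0 ≤ t ⬝ᵥ V.mulVec t := fun t =>
    poisson_const_nonneg hp' hsum'
      (fun z => Finset.sum_nonneg fun j _ => mul_nonneg (hp' z j) (sq_nonneg _)) (hwt t)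
  have hsymm : V.IsSymm := Matrix.IsSymm.ext fun q r => by
    simp only [V, gg, Matrix.of_apply, mul_comm (D q _ _)]
  have hpsd : V.PosSemidef := Matrix.PosSemidef.of_dotProduct_mulVec_nonneg
    (by rw [Matrix.IsHermitian, Matrix.conjTranspose_eq_transpose_of_trivial]; exact hsymm)
    fun t => by simpa using hv t
  refine ⟨fun q => c (g q), V, hsymm, hpsd, fun Ω _ μ _ X hX => ?_⟩
  let Y : ℕ → Ω → EuclideanSpace ℝ ι := fun K ω => WithLp.toLp 2 fun q =>
    √(K : ℝ) * (drivenSum init next (f q) (fun n => X n ω) K / K - c (g q))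
  have hY : ∀ K, Measurable (Y K) := fun K =>
    measurable_of_history hX.measurable (n := K) fun ω ω' hω => by
      simp only [Y]
      congr 1
      funext q
      rw [drivenSum_congr hω]
  refine ⟨fun K => (hY K).aemeasurable, aemeasurable_id, ?_⟩
  refine ProbabilityMeasure.tendsto_iff_tendsto_charFun.2 fun t => ?_
  simp only [ProbabilityMeasure.coe_mk, Measure.map_id, charFun_multivariateGaussian hpsd]
  let H : S → ℝ := fun z => ∑ q, t q * h (g q) z
  obtain ⟨B, hB⟩ := (Set.finite_range fun z : S => |H z|).bddAbove
  replace hB : ∀ z, |H z| ≤ B := fun z => hB ⟨z, rfl⟩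
  let M : Ω → ℕ → ℝ := fun ω => drivenSum init next (Dt t) fun n => X n ω
  have hinner : ∀ K ω, inner ℝ (Y K ω) t = (√(K : ℝ))⁻¹ * M ω K +
      (√(K : ℝ))⁻¹ * (H (drivenPath init next (fun n => X n ω) 0) -
        H (drivenPath init next (fun n => X n ω) K)) := by
    intro K ω
    have e1 : M ω K = ∑ q, t q * drivenSum init next (D q) (fun n => X n ω) K := by
      simp only [M, drivenSum, Dt, Finset.mul_sum]
      exact Finset.sum_comm
    have e2 : ∀ q, √(K : ℝ) * (drivenSum init next (f q) (fun n => X n ω) K / K - c (g q)) =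
        (√(K : ℝ))⁻¹ * (drivenSum init next (D q) (fun n => X n ω) K +
          (h (g q) (drivenPath init next (fun n => X n ω) 0) -
            h (g q) (drivenPath init next (fun n => X n ω) K))) := by
      intro q
      rcases Nat.eq_zero_or_pos K with rfl | hK
      · simp
      · have hK : (0 : ℝ) < K := by exact_mod_cast hK
        have hs : √(K : ℝ) * √(K : ℝ) = K := Real.mul_self_sqrt hK.le
        have hs0 : √(K : ℝ) ≠ 0 := (Real.sqrt_pos.2 hK).ne'
        rw [drivenSum_eq_add_coboundary (f q) (h (g q)) (c (g q)), eq_inv_mul_iff_mul_eq₀ hs0,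
          ← mul_assoc, hs]
        simp only [D]
        field_simp
        ring
    simp only [PiLp.inner_apply, Y, e2, e1, H, RCLike.inner_apply, conj_trivial,
      Finset.mul_sum, ← Finset.sum_sub_distrib, ← Finset.sum_add_distrib]
    exact Finset.sum_congr rfl fun q _ => by ring
  have hchar : ∀ K, charFun (μ.map (Y K)) t = ∫ ω, cexp (I * (inner ℝ (Y K ω) t : ℝ)) ∂μ := by
    intro K
    rw [charFun_apply, integral_map (hY K).aemeasurable (by fun_prop)]
    simp only [mul_comm I]
  have hM := tendsto_integral_cexp_drivenSum hX hinit hnext hp hsum (hv t) (hDt t) (hwt t)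
  have hdiff : Tendsto (fun K => charFun (μ.map (Y K)) t -
      ∫ ω, cexp (I * ((√(K : ℝ))⁻¹ * M ω K : ℝ)) ∂μ) atTop (nhds 0) := by
    have hlim : Tendsto (fun K : ℕ => (√(K : ℝ))⁻¹ * (B + B)) atTop (nhds 0) := by
      simpa using (tendsto_inv_atTop_zero.comp
        (Real.tendsto_sqrt_atTop.comp tendsto_natCast_atTop_atTop)).mul_const (B + B)
    refine squeeze_zero_norm (fun K => ?_) hlim
    rw [hchar, ← integral_sub]
    · refine (norm_integral_le_of_norm_le_const (C := (√(K : ℝ))⁻¹ * (B + B))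
        (Eventually.of_forall fun ω => ?_)).trans (by simp)
      refine (norm_cexp_I_mul_sub_le _ _).trans ?_
      rw [hinner, add_sub_cancel_left, abs_mul, abs_of_nonneg (by positivity)]
      exact mul_le_mul_of_nonneg_left ((abs_sub _ _).trans (add_le_add (hB _) (hB _)))
        (by positivity)
    · exact integrable_of_history hX.measurable (n := K) fun ω ω' hω => by
        simp only [Y, drivenSum_congr hω]
    · exact integrable_of_history hX.measurable (n := K) fun ω ω' hω => by
        simp only [M, drivenSum_congr hω]
  have := hdiff.add hM
  simp only [M, sub_add_cancel, zero_add] at this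
  convert this using 2
  simp [neg_div]

end CLT

theorem theorem4p4 (d : ℕ) (A P : Matrix (Fin d) (Fin d) ℝ)
    (hP : P ∈ Matrix.rowStochastic ℝ (Fin d))
    (hirr : P.IsIrreducible) (haper : IsAperiodicMatrix P) :
    ∃ (Gs : Matrix (Fin d) (Fin d) ℝ) (Ss : Matrix (Fin d × Fin d) (Fin d × Fin d) ℝ),
      Ss.IsSymm ∧ Ss.PosSemidef ∧
      ∀ (Ω : Type*) [MeasurableSpace Ω] (μ : Measure Ω) [IsProbabilityMeasure μ]
        (X : ℕ → Ω → Fin d), IsMarkovChain P X μ →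
        TendstoInDistribution (scaledCount A P X Gs) atTop id (fun _ => μ)
          (multivariateGaussian 0 Ss) := by
  rcases isEmpty_or_nonempty (Fin d) with hd | hd
  · -- There is no chain on the empty state space.
    refine ⟨0, 0, Matrix.isSymm_zero, .zero, fun Ω _ μ _ X _ => ?_⟩
    obtain ⟨ω⟩ := nonempty_of_isProbabilityMeasure μ
    exact hd.elim (X 0 ω)
  · obtain ⟨G, V, hsymm, hpsd, hV⟩ := exists_tendstoInDistribution_drivenSum
      (Matrix.mem_rowStochastic_iff_sum.1 hP).1 (Matrix.mem_rowStochastic_iff_sum.1 hP).2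
      (init := fun i => (i, (∅ : Set (Fin d × Fin d)))) (next := patternStep A P) (loc := Prod.fst)
      (fun _ => rfl) (fun _ _ => rfl) (exists_common_pattern hirr) (patternCount A P)
    refine ⟨Matrix.of fun k l => G (k, l), V, hsymm, hpsd, fun Ω _ μ _ X hX => ?_⟩
    have := hV Ω μ X hX
    simp only [← run_Gam_eq_drivenSum] at this
    exact this
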